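/- Let $K$ be a field. All graphs $E=(E^0,E^1,r,s)$ are row-finite directed graphs, and $\mathcal{Grph}$ is the category of these graphs with graph isomorphisms as morphisms. A set $H\subseteq E^0$ is hereditary if it contains every vertex reachable by a path from a vertex of $H$, and saturated if it contains every vertex $v$ that is neither a sink nor an infinite emitter and satisfies $r(s^{-1}(v))\subseteq H$. A point functor is a subfunctor $H\colon\mathcal{Grph}\to\mathcal{Set}$ of $E\mapsto E^0$; it is hereditary and saturated if $H(E)\subseteq E^0$ is so for every $E$. For $X\subseteq E^0$ let $I(X)$ be the two-sided ideal generated by $X$ in the Leavitt path algebra $L_K(E)$. A point functor $H$ is invariant if $f(I(H(E)))=I(H(F))$ for every ring isomorphism $f\colon L_K(E)\to L_K(F)$. For $H\subseteq E^0$ hereditary and saturated, $E/H$ is the graph with vertex set $E^0\setminus H$ and edge set $\{e\in E^1: r(e)\notin H\}$, and $\theta\colon L_K(E)/I(H)\cong L_K(E/H)$ is the canonical isomorphism, which sends the class of every vertex, edge or ghost edge of $E/H$ to that same element. For hereditary and saturated point functors $H_1,H_2$, the hereditary and saturated point functor $H_2*H_1$ assigns to $E$ the unique hereditary and saturated set $(H_2*H_1)(E)\subseteq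 E^0$ with $I(H_1(E))\subseteq I((H_2*H_1)(E))$ and $$\theta\bigl(I((H_2*H_1)(E))/I(H_1(E))\bigr)=I\bigl(H_2(E/H_1(E))\bigr),$$ where $\theta\colon L_K(E)/I(H_1(E))\cong L_K(E/H_1(E))$. **Proposition.** If $H_1,H_2,H_3$ are invariant hereditary and saturated point functors, then there is a natural isomorphism of functors $(H_1*H_2)*H_3\cong H_1*(H_2*H_3)$ from $\mathcal{Grph}$ to $\mathcal{Set}$. -/

import Mathlib

open CategoryTheory

universe u v w

/-! ## Row-finite directed graphs -/

/-- A row-finite directed graph: vertices `V`, edges `E`, source and range maps, and every vertex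
emits only finitely many edges. -/
structure RFGraph where
  V : Type u
  E : Type v
  src : E → V
  rng : E → V
  rowFinite : ∀ x : V, {e : E | src e = x}.Finite

namespace RFGraph

/-- An isomorphism of directed graphs. -/
@[ext]
structure Iso (G G' : RFGraph.{u, v}) where
  onV : G.V ≃ G'.V
  onE : G.E ≃ G'.E
  src_comm : ∀ e, G'.src (onE e) = onV (G.src e)
  rng_comm : ∀ e, G'.rng (onE e) = onV (G.rng e)

/-- The category of row-finite graphs, whose morphisms are the graph isomorphisms. -/
instance : Category.{max u v} RFGraph.{u, v} where
  Hom G G' := Iso G G'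
  id G := ⟨Equiv.refl _, Equiv.refl _, fun _ => rfl, fun _ => rfl⟩
  comp α β :=
    ⟨α.onV.trans β.onV, α.onE.trans β.onE,
      fun e => by simp [α.src_comm, β.src_comm], fun e => by simp [α.rng_comm, β.rng_comm]⟩

/-- The functor sending a graph to its set of vertices. -/
def vertexFunctor : RFGraph.{u, v} ⥤ Type u where
  obj G := G.V
  map {G G'} (α : Iso G G') := ↾ (fun x : G.V => α.onV x)

variable (G : RFGraph.{u, v})

/-- `G.Reach x y` (in symbols `x ≥ y`): there is a (possibly trivial) path from `x` to `y`. -/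
def Reach : G.V → G.V → Prop :=
  Relation.ReflTransGen (fun x y => ∃ e, G.src e = x ∧ G.rng e = y)

/-- A set of vertices is hereditary if it is closed under following paths. -/
def IsHereditary (H : Set G.V) : Prop :=
  ∀ x ∈ H, ∀ y, G.Reach x y → y ∈ H

/-- A regular vertex: neither a sink nor an infinite emitter. -/
def IsRegular (x : G.V) : Prop :=
  {e : G.E | G.src e = x}.Nonempty ∧ {e : G.E | G.src e = x}.Finite

/-- A set of vertices is saturated if it contains every regular vertex all of whose out-edges end
in the set. -/
def IsSaturated (H : Set G.V) : Prop :=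
  ∀ x, G.IsRegular x → (∀ e, G.src e = x → G.rng e ∈ H) → x ∈ H

/-- Hereditary and saturated sets of vertices. -/
structure IsHerSat (H : Set G.V) : Prop where
  her : G.IsHereditary H
  sat : G.IsSaturated H

variable {G}

theorem IsHereditary.rng_mem {H : Set G.V} (hH : G.IsHereditary H) (e : G.E)
    (h : G.src e ∈ H) : G.rng e ∈ H :=
  hH _ h _ (Relation.ReflTransGen.single ⟨e, rfl, rfl⟩)

theorem isHereditary_of_rng {H : Set G.V} (h : ∀ e, G.src e ∈ H → G.rng e ∈ H) :
    G.IsHereditary H := by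
  intro x hx y hxy
  induction hxy with
  | refl => exact hx
  | tail _ hbc ih =>
    obtain ⟨e, rfl, rfl⟩ := hbc
    exact h e ih

/-- The quotient graph `G / H` by a hereditary set `H`: its vertices are the vertices of `G`
outside `H`, its edges are the edges of `G` whose range is outside `H`. -/
def quot (G : RFGraph.{u, v}) (H : Set G.V) (hH : G.IsHereditary H) : RFGraph.{u, v} where
  V := {x : G.V // x ∉ H}
  E := {e : G.E // G.rng e ∉ H}
  src e := ⟨G.src e.1, fun h => e.2 (hH.rng_mem e.1 h)⟩
  rng e := ⟨G.rng e.1, e.2⟩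
  rowFinite x := by
    refine Set.Finite.of_finite_image ((G.rowFinite x.1).subset ?_)
      (Subtype.val_injective.injOn)
    rintro _ ⟨e, he, rfl⟩
    exact congrArg Subtype.val he

/-- An isomorphism of graphs induces an isomorphism between quotient graphs. -/
def Iso.quot {G G' : RFGraph.{u, v}} (α : Iso G G') {H : Set G.V} {H' : Set G'.V}
    (hH : G.IsHereditary H) (hH' : G'.IsHereditary H') (h : ∀ x, α.onV x ∈ H' ↔ x ∈ H) :
    Iso (G.quot H hH) (G'.quot H' hH') where
  onV := α.onV.subtypeEquiv fun x => not_congr (h x).symm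
  onE := α.onE.subtypeEquiv fun e => by rw [α.rng_comm, h]
  src_comm e := Subtype.ext (α.src_comm e.1)
  rng_comm e := Subtype.ext (α.rng_comm e.1)

end RFGraph

/-! ## Quotients of non-unital algebras by congruences that respect scalars -/

namespace ScalarCon

variable {K : Type*} [Field K] {R : Type*} [NonUnitalRing R] [Module K R]

/-- The vector space structure on the quotient by a ring congruence that respects scalars. -/
@[reducible]
def module (c : RingCon R) (hc : ∀ (k : K) (x y : R), c x y → c (k • x) (k • y)) :
    Module K c.Quotient where
  smul k x := c.smulAux hc k x
  one_smul := by
    rintro ⟨x⟩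
    exact congrArg (Quot.mk _) (one_smul K x)
  mul_smul := by
    rintro k l ⟨x⟩
    exact congrArg (Quot.mk _) (mul_smul k l x)
  smul_zero k := congrArg (Quot.mk _) (smul_zero k)
  smul_add := by
    rintro k ⟨x⟩ ⟨y⟩
    exact congrArg (Quot.mk _) (smul_add k x y)
  add_smul := by
    rintro k l ⟨x⟩
    exact congrArg (Quot.mk _) (add_smul k l x)
  zero_smul := by
    rintro ⟨x⟩
    exact congrArg (Quot.mk _) (zero_smul K x)

end ScalarCon

/-! ## Leavitt path algebras -/

/-- The generators of the Leavitt path algebra: the vertices, the edges `e` and the ghost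
edges `e*`. -/
inductive LeavittGen (G : RFGraph.{u, v}) : Type (max u v)
  | vertex : G.V → LeavittGen G
  | edge : G.E → LeavittGen G
  | ghost : G.E → LeavittGen G

/-- The free associative (non-unital) `K`-algebra on a set `X`: the semigroup algebra of the free
semigroup on `X`. -/
abbrev FreeNonUnitalAlg (K : Type w) [Field K] (X : Type u) := MonoidAlgebra K (FreeSemigroup X)

/-- A generator, as an element of the free algebra. -/
noncomputable def FreeNonUnitalAlg.gen (K : Type w) [Field K] {X : Type u} (x : X) :
    FreeNonUnitalAlg K X :=
  MonoidAlgebra.ofMagma K _ (FreeSemigroup.of x)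

namespace Leavitt

open LeavittGen FreeNonUnitalAlg

variable (K : Type w) [Field K] (G : RFGraph.{u, v})

/-- The defining relations of the Leavitt path algebra: orthogonality of the vertices, the path
algebra relations of the extended graph, and the two Cuntz-Krieger relations. -/
inductive Rel : FreeNonUnitalAlg K (LeavittGen G) → FreeNonUnitalAlg K (LeavittGen G) → Prop
  | vertex_idem (x : G.V) : Rel (gen K (vertex x) * gen K (vertex x)) (gen K (vertex x))
  | vertex_orth (x y : G.V) (h : x ≠ y) : Rel (gen K (vertex x) * gen K (vertex y)) 0
  | src_edge (e : G.E) : Rel (gen K (vertex (G.src e)) * gen K (edge e)) (gen K (edge e))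
  | edge_rng (e : G.E) : Rel (gen K (edge e) * gen K (vertex (G.rng e))) (gen K (edge e))
  | rng_ghost (e : G.E) : Rel (gen K (vertex (G.rng e)) * gen K (ghost e)) (gen K (ghost e))
  | ghost_src (e : G.E) : Rel (gen K (ghost e) * gen K (vertex (G.src e))) (gen K (ghost e))
  | ck1 (e : G.E) : Rel (gen K (ghost e) * gen K (edge e)) (gen K (vertex (G.rng e)))
  | ck1_orth (e f : G.E) (h : e ≠ f) : Rel (gen K (ghost e) * gen K (edge f)) 0
  | ck2 (x : G.V) (h : G.IsRegular x) :
      Rel (∑ e ∈ (G.rowFinite x).toFinset, gen K (edge e) * gen K (ghost e)) (gen K (vertex x))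

/-- The ring congruence generated by all scalar multiples of the defining relations. As the free
algebra has no unit, the scalar multiples are needed to get an algebra congruence. -/
noncomputable def con : RingCon (FreeNonUnitalAlg K (LeavittGen G)) :=
  ringConGen (fun a b => ∃ (k : K) (a' b' : FreeNonUnitalAlg K (LeavittGen G)),
    Rel K G a' b' ∧ a = k • a' ∧ b = k • b')

theorem con_smul (k : K) (x y : FreeNonUnitalAlg K (LeavittGen G)) (h : con K G x y) :
    con K G (k • x) (k • y) := by
  induction h with
  | of x y h =>
    obtain ⟨l, a, b, hab, rfl, rfl⟩ := h
    exact RingConGen.Rel.of _ _ ⟨k * l, a, b, hab, by rw [mul_smul], by rw [mul_smul]⟩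
  | refl x => exact RingConGen.Rel.refl _
  | symm _ ih => exact RingConGen.Rel.symm ih
  | trans _ _ ih₁ ih₂ => exact RingConGen.Rel.trans ih₁ ih₂
  | add _ _ ih₁ ih₂ => rw [smul_add, smul_add]; exact RingConGen.Rel.add ih₁ ih₂
  | mul _ h₂ ih₁ _ =>
    rw [← smul_mul_assoc, ← smul_mul_assoc]; exact RingConGen.Rel.mul ih₁ h₂

end Leavitt

/-- The Leavitt path algebra `L_K(G)`. -/
def LPA (K : Type w) [Field K] (G : RFGraph.{u, v}) := (Leavitt.con K G).Quotient

namespace LPA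

open LeavittGen FreeNonUnitalAlg

variable (K : Type w) [Field K] (G : RFGraph.{u, v})

noncomputable instance : NonUnitalRing (LPA K G) :=
  inferInstanceAs (NonUnitalRing (Leavitt.con K G).Quotient)

noncomputable instance : Module K (LPA K G) :=
  ScalarCon.module (Leavitt.con K G) (Leavitt.con_smul K G)

instance : IsScalarTower K (LPA K G) (LPA K G) where
  smul_assoc := by
    rintro k ⟨x⟩ ⟨y⟩
    exact congrArg (Quot.mk _) (smul_mul_assoc k x y)

instance : SMulCommClass K (LPA K G) (LPA K G) where
  smul_comm := by
    rintro k ⟨x⟩ ⟨y⟩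
    exact congrArg (Quot.mk _) (mul_smul_comm k x y).symm

/-- The projection from the free algebra. -/
noncomputable def ofFree : FreeNonUnitalAlg K (LeavittGen G) →ₙₐ[K] LPA K G where
  toFun x := (x : (Leavitt.con K G).Quotient)
  map_smul' _ _ := rfl
  map_zero' := rfl
  map_add' _ _ := rfl
  map_mul' _ _ := rfl

variable {G}

/-- A vertex, as an element of `L_K(G)`. -/
noncomputable def vert (x : G.V) : LPA K G := ofFree K G (gen K (vertex x))

/-- An edge, as an element of `L_K(G)`. -/
noncomputable def edg (e : G.E) : LPA K G := ofFree K G (gen K (edge e))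

/-- A ghost edge, as an element of `L_K(G)`. -/
noncomputable def gho (e : G.E) : LPA K G := ofFree K G (gen K (ghost e))

/-- The ideal `I(H)` of `L_K(G)` generated by a set `H` of vertices. -/
noncomputable def vertexIdeal (H : Set G.V) : TwoSidedIdeal (LPA K G) :=
  TwoSidedIdeal.span (vert K '' H)

end LPA

namespace Leavitt

/-- A family of elements of an algebra satisfying the defining relations of `L_K(G)`. -/
structure IsFamily (G : RFGraph.{u, v}) {A : Type*} [NonUnitalRing A]
    (p : G.V → A) (s t : G.E → A) : Prop where
  vertex_idem : ∀ x, p x * p x = p x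
  vertex_orth : ∀ x y, x ≠ y → p x * p y = 0
  src_edge : ∀ e, p (G.src e) * s e = s e
  edge_rng : ∀ e, s e * p (G.rng e) = s e
  rng_ghost : ∀ e, p (G.rng e) * t e = t e
  ghost_src : ∀ e, t e * p (G.src e) = t e
  ck1 : ∀ e, t e * s e = p (G.rng e)
  ck1_orth : ∀ e f, e ≠ f → t e * s f = 0
  ck2 : ∀ x, G.IsRegular x → ∑ e ∈ (G.rowFinite x).toFinset, s e * t e = p x

end Leavitt

namespace LPA

open LeavittGen FreeNonUnitalAlg

section universal

variable (K : Type w) [Field K] (G : RFGraph.{u, v})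

theorem ofFree_eq {a b : FreeNonUnitalAlg K (LeavittGen G)} (h : Leavitt.Rel K G a b) :
    ofFree K G a = ofFree K G b :=
  (RingCon.eq _).2 (RingConGen.Rel.of _ _ ⟨1, a, b, h, (one_smul _ _).symm, (one_smul _ _).symm⟩)

theorem isFamily : Leavitt.IsFamily G (vert K (G := G)) (edg K) (gho K) where
  vertex_idem x := by
    simpa [vert, map_mul] using ofFree_eq K G (.vertex_idem x)
  vertex_orth x y h := by
    simpa [vert, map_mul] using ofFree_eq K G (.vertex_orth x y h)
  src_edge e := by simpa [vert, edg, map_mul] using ofFree_eq K G (.src_edge e)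
  edge_rng e := by simpa [vert, edg, map_mul] using ofFree_eq K G (.edge_rng e)
  rng_ghost e := by simpa [vert, gho, map_mul] using ofFree_eq K G (.rng_ghost e)
  ghost_src e := by simpa [vert, gho, map_mul] using ofFree_eq K G (.ghost_src e)
  ck1 e := by simpa [vert, edg, gho, map_mul] using ofFree_eq K G (.ck1 e)
  ck1_orth e f h := by simpa [edg, gho, map_mul] using ofFree_eq K G (.ck1_orth e f h)
  ck2 x h := by
    simpa [vert, edg, gho, map_mul, map_sum] using ofFree_eq K G (.ck2 x h)

variable {K G} {A : Type*} [NonUnitalRing A] [Module K A] [IsScalarTower K A A]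
  [SMulCommClass K A A]

/-- The map on generators given by a family. -/
def genMap (p : G.V → A) (s t : G.E → A) : LeavittGen G → A
  | vertex x => p x
  | edge e => s e
  | ghost e => t e

/-- The induced map on the free algebra. -/
noncomputable def freeLift (p : G.V → A) (s t : G.E → A) :
    FreeNonUnitalAlg K (LeavittGen G) →ₙₐ[K] A :=
  MonoidAlgebra.liftMagma K (FreeSemigroup.lift (genMap p s t))

theorem freeLift_gen (p : G.V → A) (s t : G.E → A) (x : LeavittGen G) :
    freeLift (K := K) p s t (gen K x) = genMap p s t x := by
  have := congrArg (fun f => f (FreeSemigroup.of x))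
    ((MonoidAlgebra.liftMagma K).symm_apply_apply (FreeSemigroup.lift (genMap p s t)))
  exact this.trans (FreeSemigroup.lift_of _ _)

theorem freeLift_con {p : G.V → A} {s t : G.E → A} (h : Leavitt.IsFamily G p s t)
    {a b : FreeNonUnitalAlg K (LeavittGen G)} (hab : Leavitt.con K G a b) :
    freeLift (K := K) p s t a = freeLift p s t b := by
  induction hab with
  | of x y hxy =>
    obtain ⟨k, a, b, hr, rfl, rfl⟩ := hxy
    rw [map_smul, map_smul]
    congr 1
    cases hr with
    | vertex_idem x => simpa [freeLift_gen, genMap] using h.vertex_idem x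
    | vertex_orth x y hxy => simpa [freeLift_gen, genMap] using h.vertex_orth x y hxy
    | src_edge e => simpa [freeLift_gen, genMap] using h.src_edge e
    | edge_rng e => simpa [freeLift_gen, genMap] using h.edge_rng e
    | rng_ghost e => simpa [freeLift_gen, genMap] using h.rng_ghost e
    | ghost_src e => simpa [freeLift_gen, genMap] using h.ghost_src e
    | ck1 e => simpa [freeLift_gen, genMap] using h.ck1 e
    | ck1_orth e f hef => simpa [freeLift_gen, genMap] using h.ck1_orth e f hef
    | ck2 x hx => simpa [freeLift_gen, genMap, map_sum] using h.ck2 x hx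
  | refl x => rfl
  | symm _ ih => exact ih.symm
  | trans _ _ ih₁ ih₂ => exact ih₁.trans ih₂
  | add _ _ ih₁ ih₂ => rw [map_add, map_add, ih₁, ih₂]
  | mul _ _ ih₁ ih₂ => rw [map_mul, map_mul, ih₁, ih₂]

/-- The universal property of the Leavitt path algebra. -/
noncomputable def lift {p : G.V → A} {s t : G.E → A} (h : Leavitt.IsFamily G p s t) :
    LPA K G →ₙₐ[K] A where
  toFun := Quot.lift (freeLift p s t) (fun _ _ hab => freeLift_con h hab)
  map_smul' := by
    rintro k ⟨x⟩
    exact map_smul (freeLift p s t) k x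
  map_zero' := map_zero (freeLift (K := K) p s t)
  map_add' := by
    rintro ⟨x⟩ ⟨y⟩
    exact map_add (freeLift p s t) x y
  map_mul' := by
    rintro ⟨x⟩ ⟨y⟩
    exact map_mul (freeLift p s t) x y

section
variable {p : G.V → A} {s t : G.E → A} (h : Leavitt.IsFamily G p s t)

@[simp] theorem lift_vert (x : G.V) : lift (K := K) h (vert K x) = p x := freeLift_gen p s t _
@[simp] theorem lift_edg (e : G.E) : lift (K := K) h (edg K e) = s e := freeLift_gen p s t _
@[simp] theorem lift_gho (e : G.E) : lift (K := K) h (gho K e) = t e := freeLift_gen p s t _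
end

theorem hom_ext {f g : LPA K G →ₙₐ[K] A} (hv : ∀ x, f (vert K x) = g (vert K x))
    (he : ∀ e, f (edg K e) = g (edg K e)) (hg : ∀ e, f (gho K e) = g (gho K e)) : f = g := by
  have key : f.comp (ofFree K G) = g.comp (ofFree K G) := by
    apply MonoidAlgebra.nonUnitalAlgHom_ext'
    apply FreeSemigroup.hom_ext
    funext x
    cases x with
    | vertex x => exact hv x
    | edge e => exact he e
    | ghost e => exact hg e
  ext x
  obtain ⟨x⟩ := x
  exact DFunLike.congr_fun key x

end universal

/-! ### The quotient `L_K(G) / I(H)` -/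

section quotient

variable (K : Type w) [Field K] {G : RFGraph.{u, v}}

theorem vert_mem {H : Set G.V} {x : G.V} (hx : x ∈ H) : vert K x ∈ vertexIdeal K H :=
  TwoSidedIdeal.subset_span ⟨x, hx, rfl⟩

theorem vertexIdeal_le {H : Set G.V} {J : TwoSidedIdeal (LPA K G)} :
    vertexIdeal K H ≤ J ↔ ∀ x ∈ H, vert K x ∈ J := by
  rw [vertexIdeal, TwoSidedIdeal.span_le]
  exact Set.image_subset_iff

theorem smul_mem_vertexIdeal {H : Set G.V} (k : K) {x : LPA K G} (hx : x ∈ vertexIdeal K H) :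
    k • x ∈ vertexIdeal K H := by
  refine TwoSidedIdeal.span_induction (p := fun x _ => k • x ∈ vertexIdeal K H)
    ?_ ?_ ?_ ?_ ?_ ?_ hx
  · rintro _ ⟨x, hx, rfl⟩
    rw [← (isFamily K G).vertex_idem x, ← smul_mul_assoc]
    exact TwoSidedIdeal.mul_mem_left _ _ _ (vert_mem K hx)
  · rw [smul_zero]; exact TwoSidedIdeal.zero_mem _
  · intro x y _ _ hx hy
    rw [smul_add]; exact TwoSidedIdeal.add_mem _ hx hy
  · intro x _ hx
    rw [smul_neg]; exact TwoSidedIdeal.neg_mem _ hx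
  · intro a x _ hx
    rw [← mul_smul_comm]; exact TwoSidedIdeal.mul_mem_left _ _ _ hx
  · intro a x _ hx
    rw [← smul_mul_assoc]; exact TwoSidedIdeal.mul_mem_right _ _ _ hx

/-- The quotient algebra `L_K(G) / I(H)`. -/
def QuotAlg (H : Set G.V) := (vertexIdeal K H).ringCon.Quotient

variable (H : Set G.V)

theorem vertexIdeal_con_smul (k : K) (x y : LPA K G) (h : (vertexIdeal K H).ringCon x y) :
    (vertexIdeal K H).ringCon (k • x) (k • y) := by
  rw [TwoSidedIdeal.rel_iff] at h ⊢
  rw [← smul_sub]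
  exact smul_mem_vertexIdeal K k h

noncomputable instance : NonUnitalRing (QuotAlg K H) :=
  inferInstanceAs (NonUnitalRing (vertexIdeal K H).ringCon.Quotient)

noncomputable instance : Module K (QuotAlg K H) :=
  ScalarCon.module (vertexIdeal K H).ringCon (vertexIdeal_con_smul K H)

instance : IsScalarTower K (QuotAlg K H) (QuotAlg K H) where
  smul_assoc := by
    rintro k ⟨x⟩ ⟨y⟩
    exact congrArg (Quot.mk _) (smul_mul_assoc k x y)

instance : SMulCommClass K (QuotAlg K H) (QuotAlg K H) where
  smul_comm := by
    rintro k ⟨x⟩ ⟨y⟩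
    exact congrArg (Quot.mk _) (mul_smul_comm k x y).symm

/-- The quotient map `L_K(G) → L_K(G) / I(H)`. -/
noncomputable def toQuot : LPA K G →ₙₐ[K] QuotAlg K H where
  toFun x := (x : (vertexIdeal K H).ringCon.Quotient)
  map_smul' _ _ := rfl
  map_zero' := rfl
  map_add' _ _ := rfl
  map_mul' _ _ := rfl

theorem toQuot_eq_zero {x : LPA K G} : toQuot K H x = 0 ↔ x ∈ vertexIdeal K H :=
  (RingCon.eq _).trans (TwoSidedIdeal.mem_iff _ _).symm

variable {H}

open Classical in
/-- The images in `L_K(G / H)` of the generators of `L_K(G)` satisfy the defining relations. -/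
theorem isFamily_quot (hH : G.IsHerSat H) :
    Leavitt.IsFamily G (A := LPA K (G.quot H hH.her))
      (fun x => if h : x ∈ H then 0 else vert K ⟨x, h⟩)
      (fun e => if h : G.rng e ∈ H then 0 else edg K ⟨e, h⟩)
      (fun e => if h : G.rng e ∈ H then 0 else gho K ⟨e, h⟩) := by
  have F := isFamily K (G.quot H hH.her)
  have hs : ∀ e, G.rng e ∉ H → G.src e ∉ H := fun e he h => he (hH.her.rng_mem e h)
  refine ⟨?_, ?_, ?_, ?_, ?_, ?_, ?_, ?_, ?_⟩
  · intro x
    by_cases h : x ∈ H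
    · simp [h]
    · simpa [h] using F.vertex_idem ⟨x, h⟩
  · intro x y hxy
    by_cases h : x ∈ H
    · simp [h]
    by_cases h' : y ∈ H
    · simp [h']
    · simpa [h, h'] using F.vertex_orth ⟨x, h⟩ ⟨y, h'⟩ (fun hh => hxy (congrArg Subtype.val hh))
  · intro e
    by_cases h : G.rng e ∈ H
    · simp [h]
    · rw [dif_neg (hs e h), dif_neg h]
      exact F.src_edge ⟨e, h⟩
  · intro e
    by_cases h : G.rng e ∈ H
    · simp [h]
    · rw [dif_neg h, dif_neg h]
      exact F.edge_rng ⟨e, h⟩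
  · intro e
    by_cases h : G.rng e ∈ H
    · simp [h]
    · rw [dif_neg h, dif_neg h]
      exact F.rng_ghost ⟨e, h⟩
  · intro e
    by_cases h : G.rng e ∈ H
    · simp [h]
    · rw [dif_neg (hs e h), dif_neg h]
      exact F.ghost_src ⟨e, h⟩
  · intro e
    by_cases h : G.rng e ∈ H
    · simp [h]
    · rw [dif_neg h, dif_neg h, dif_neg h]
      exact F.ck1 ⟨e, h⟩
  · intro e f hef
    by_cases h : G.rng e ∈ H
    · simp [h]
    by_cases h' : G.rng f ∈ H
    · simp [h']
    · simpa [h, h'] using F.ck1_orth ⟨e, h⟩ ⟨f, h'⟩ (fun hh => hef (congrArg Subtype.val hh))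
  · intro x hx
    by_cases h : x ∈ H
    · rw [dif_pos h]
      refine Finset.sum_eq_zero fun e he => ?_
      have he' : G.src e = x := by simpa using he
      have : G.rng e ∈ H := hH.her.rng_mem e (he' ▸ h)
      simp [this]
    · rw [dif_neg h]
      have hreg : (G.quot H hH.her).IsRegular ⟨x, h⟩ := by
        refine ⟨?_, (G.quot H hH.her).rowFinite _⟩
        by_contra hne
        refine h (hH.sat x hx fun e he => ?_)
        by_contra hr
        exact hne ⟨⟨e, hr⟩, Subtype.ext he⟩
      rw [← F.ck2 ⟨x, h⟩ hreg]
      symm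
      refine Finset.sum_of_injOn (fun e => e.1) (Subtype.val_injective.injOn) ?_ ?_ ?_
      · intro e he
        have he' : (G.quot H hH.her).src e = ⟨x, h⟩ := by simpa using he
        have h₂ : G.src e.1 = x := congrArg Subtype.val he'
        simpa using h₂
      · intro e he hne
        have he' : G.src e = x := by simpa using he
        by_cases hr : G.rng e ∈ H
        · simp [hr]
        · refine absurd ⟨⟨e, hr⟩, ?_, rfl⟩ hne
          exact (Set.Finite.mem_toFinset _).2
            (Subtype.ext (a1 := (G.quot H hH.her).src ⟨e, hr⟩) (a2 := ⟨x, h⟩) he')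
      · intro e _
        have hr : G.rng e.1 ∉ H := e.2
        rw [dif_neg hr, dif_neg hr]
        rfl

/-- The images in `L_K(G) / I(H)` of vertices, edges and ghost edges of `G / H` satisfy the
defining relations of `L_K(G / H)`. -/
theorem isFamily_toQuot (hH : G.IsHerSat H) :
    Leavitt.IsFamily (G.quot H hH.her) (A := QuotAlg K H)
      (fun x => toQuot K H (vert K x.1))
      (fun e => toQuot K H (edg K e.1))
      (fun e => toQuot K H (gho K e.1)) := by
  have F := isFamily K G
  refine ⟨?_, ?_, ?_, ?_, ?_, ?_, ?_, ?_, ?_⟩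
  · intro x; rw [← map_mul, F.vertex_idem]
  · intro x y hxy
    rw [← map_mul, F.vertex_orth _ _ (fun h => hxy (Subtype.ext h)), map_zero]
  · intro e; rw [← map_mul]; exact congrArg _ (F.src_edge e.1)
  · intro e; rw [← map_mul]; exact congrArg _ (F.edge_rng e.1)
  · intro e; rw [← map_mul]; exact congrArg _ (F.rng_ghost e.1)
  · intro e; rw [← map_mul]; exact congrArg _ (F.ghost_src e.1)
  · intro e; rw [← map_mul]; exact congrArg _ (F.ck1 e.1)
  · intro e f hef
    rw [← map_mul, F.ck1_orth _ _ (fun h => hef (Subtype.ext h)), map_zero]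
  · intro x hx
    have hreg : G.IsRegular x.1 := by
      obtain ⟨e, he⟩ := hx.1
      exact ⟨⟨e.1, congrArg Subtype.val he⟩, G.rowFinite _⟩
    rw [← F.ck2 x.1 hreg, map_sum]
    refine Finset.sum_of_injOn (fun e => e.1) (Subtype.val_injective.injOn) ?_ ?_ ?_
    · intro e he
      have he' : (G.quot H hH.her).src e = x := by simpa using he
      have h₂ : G.src e.1 = x.1 := congrArg Subtype.val he'
      simpa using h₂
    · intro e he hne
      have he' : G.src e = x.1 := by simpa using he
      by_cases hr : G.rng e ∈ H
      · rw [toQuot_eq_zero, ← F.edge_rng e]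
        exact TwoSidedIdeal.mul_mem_right _ _ _
          (TwoSidedIdeal.mul_mem_left _ _ _ (vert_mem K hr))
      · refine absurd ⟨⟨e, hr⟩, ?_, rfl⟩ hne
        exact (Set.Finite.mem_toFinset _).2
          (Subtype.ext (a1 := (G.quot H hH.her).src ⟨e, hr⟩) (a2 := x) he')
    · intro e _
      rw [map_mul]

/-- The canonical homomorphism `L_K(G) → L_K(G / H)`, which sends a vertex or edge of `G / H` to
itself and all other vertices and edges to zero. -/
noncomputable def proj (hH : G.IsHerSat H) : LPA K G →ₙₐ[K] LPA K (G.quot H hH.her) :=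
  lift (isFamily_quot K hH)

theorem proj_vert_of_mem (hH : G.IsHerSat H) {x : G.V} (h : x ∈ H) :
    proj K hH (vert K x) = 0 := by
  simp [proj, h]

theorem proj_vert (hH : G.IsHerSat H) (x : {x : G.V // x ∉ H}) :
    proj K hH (vert K x.1) = vert K (G := G.quot H hH.her) x := by
  simp [proj, x.2]

theorem proj_edg_of_mem (hH : G.IsHerSat H) {e : G.E} (h : G.rng e ∈ H) :
    proj K hH (edg K e) = 0 := by
  simp [proj, h]

theorem proj_edg (hH : G.IsHerSat H) (e : {e : G.E // G.rng e ∉ H}) :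
    proj K hH (edg K e.1) = edg K (G := G.quot H hH.her) e := by
  simp [proj, e.2]

theorem proj_gho_of_mem (hH : G.IsHerSat H) {e : G.E} (h : G.rng e ∈ H) :
    proj K hH (gho K e) = 0 := by
  simp [proj, h]

theorem proj_gho (hH : G.IsHerSat H) (e : {e : G.E // G.rng e ∉ H}) :
    proj K hH (gho K e.1) = gho K (G := G.quot H hH.her) e := by
  simp [proj, e.2]

theorem vertexIdeal_le_ker (hH : G.IsHerSat H) {x : LPA K G} (hx : x ∈ vertexIdeal K H) :
    proj K hH x = 0 := by
  have : vertexIdeal K H ≤ TwoSidedIdeal.ker (proj K hH) :=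
    (vertexIdeal_le K).2 fun x hx => (TwoSidedIdeal.mem_ker _).2 (proj_vert_of_mem K hH hx)
  exact (TwoSidedIdeal.mem_ker _).1 (this hx)

/-- The homomorphism `L_K(G) / I(H) → L_K(G / H)` induced by `proj`. -/
noncomputable def quotToLPA (hH : G.IsHerSat H) : QuotAlg K H →ₙₐ[K] LPA K (G.quot H hH.her) where
  toFun := Quot.lift (proj K hH) (fun a b hab => by
    rw [← sub_eq_zero, ← map_sub]
    exact vertexIdeal_le_ker K hH (((vertexIdeal K H).rel_iff a b).1 hab))
  map_smul' := by
    rintro k ⟨x⟩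
    exact map_smul (proj K hH) k x
  map_zero' := map_zero (proj K hH)
  map_add' := by
    rintro ⟨x⟩ ⟨y⟩
    exact map_add (proj K hH) x y
  map_mul' := by
    rintro ⟨x⟩ ⟨y⟩
    exact map_mul (proj K hH) x y

@[simp] theorem quotToLPA_toQuot (hH : G.IsHerSat H) (x : LPA K G) :
    quotToLPA K hH (toQuot K H x) = proj K hH x := rfl

/-- The inverse homomorphism `L_K(G / H) → L_K(G) / I(H)`. -/
noncomputable def lpaToQuot (hH : G.IsHerSat H) : LPA K (G.quot H hH.her) →ₙₐ[K] QuotAlg K H :=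
  lift (isFamily_toQuot K hH)

theorem lpaToQuot_proj (hH : G.IsHerSat H) (x : LPA K G) :
    lpaToQuot K hH (proj K hH x) = toQuot K H x := by
  have F := isFamily K G
  have : (lpaToQuot K hH).comp (proj K hH) = toQuot K H := by
    refine hom_ext (fun x => ?_) (fun e => ?_) (fun e => ?_)
    · by_cases h : x ∈ H
      · rw [NonUnitalAlgHom.comp_apply, proj_vert_of_mem K hH h, map_zero]
        exact ((toQuot_eq_zero K H).2 (vert_mem K h)).symm
      · rw [NonUnitalAlgHom.comp_apply, proj_vert K hH ⟨x, h⟩]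
        exact lift_vert _ _
    · by_cases h : G.rng e ∈ H
      · rw [NonUnitalAlgHom.comp_apply, proj_edg_of_mem K hH h, map_zero, eq_comm,
          toQuot_eq_zero, ← F.edge_rng]
        exact TwoSidedIdeal.mul_mem_left _ _ _ (vert_mem K h)
      · rw [NonUnitalAlgHom.comp_apply, proj_edg K hH ⟨e, h⟩]
        exact lift_edg _ _
    · by_cases h : G.rng e ∈ H
      · rw [NonUnitalAlgHom.comp_apply, proj_gho_of_mem K hH h, map_zero, eq_comm,
          toQuot_eq_zero, ← F.rng_ghost]
        exact TwoSidedIdeal.mul_mem_right _ _ _ (vert_mem K h)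
      · rw [NonUnitalAlgHom.comp_apply, proj_gho K hH ⟨e, h⟩]
        exact lift_gho _ _
  exact DFunLike.congr_fun this x

theorem quotToLPA_lpaToQuot (hH : G.IsHerSat H) (x : LPA K (G.quot H hH.her)) :
    quotToLPA K hH (lpaToQuot K hH x) = x := by
  have : (quotToLPA K hH).comp (lpaToQuot K hH) = NonUnitalAlgHom.id K _ := by
    refine hom_ext (fun x => ?_) (fun e => ?_) (fun e => ?_)
    · rw [NonUnitalAlgHom.comp_apply, lpaToQuot, lift_vert, quotToLPA_toQuot]; exact proj_vert K hH x
    · rw [NonUnitalAlgHom.comp_apply, lpaToQuot, lift_edg, quotToLPA_toQuot]; exact proj_edg K hH e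
    · rw [NonUnitalAlgHom.comp_apply, lpaToQuot, lift_gho, quotToLPA_toQuot]; exact proj_gho K hH e
  exact DFunLike.congr_fun this x

/-- The canonical isomorphism `θ : L_K(G) / I(H) ≅ L_K(G / H)`, for `H` hereditary and
saturated. -/
noncomputable def theta (hH : G.IsHerSat H) : QuotAlg K H ≃+* LPA K (G.quot H hH.her) where
  toFun := quotToLPA K hH
  invFun := lpaToQuot K hH
  left_inv := by
    rintro ⟨x⟩
    exact lpaToQuot_proj K hH x
  right_inv := quotToLPA_lpaToQuot K hH
  map_mul' := map_mul _
  map_add' := map_add _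

@[simp] theorem theta_toQuot (hH : G.IsHerSat H) (x : LPA K G) :
    theta K hH (toQuot K H x) = proj K hH x := rfl

theorem proj_surjective (hH : G.IsHerSat H) : Function.Surjective (proj K hH) := by
  intro y
  obtain ⟨⟨x⟩, rfl⟩ := (theta K hH).surjective y
  exact ⟨x, rfl⟩

theorem proj_eq_zero (hH : G.IsHerSat H) {x : LPA K G} :
    proj K hH x = 0 ↔ x ∈ vertexIdeal K H := by
  rw [← toQuot_eq_zero, ← theta_toQuot]
  exact map_eq_zero_iff _ (theta K hH).injective

end quotient

/-! ### Vertices are nonzero in `L_K(G)` -/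

section nonzero

variable (K : Type w) [Field K] (G : RFGraph.{u, v})

theorem exists_code : ∃ j : G.E × ℕ → G.V × ℕ, Function.Injective j ∧
    (∀ a, (j a).1 = G.src a.1) ∧ ∀ x n, G.IsRegular x → ∃ a, j a = (x, n) := by
  have key : ∀ x : G.V, ∃ φ : {e : G.E // G.src e = x} × ℕ → ℕ,
      Function.Injective φ ∧ (G.IsRegular x → Function.Surjective φ) := by
    intro x
    have : Finite {e : G.E // G.src e = x} := G.rowFinite x
    by_cases hx : Nonempty {e : G.E // G.src e = x}
    · obtain ⟨_⟩ := nonempty_denumerable ({e : G.E // G.src e = x} × ℕ)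
      exact ⟨Denumerable.eqv _, (Denumerable.eqv _).injective,
        fun _ => (Denumerable.eqv _).surjective⟩
    · refine ⟨fun _ => 0, fun a => absurd ⟨a.1⟩ hx, fun h => ?_⟩
      obtain ⟨e, he⟩ := h.1
      exact absurd ⟨⟨e, he⟩⟩ hx
  choose φ hφ hφ' using key
  refine ⟨fun a => (G.src a.1, φ (G.src a.1) (⟨a.1, rfl⟩, a.2)), ?_, fun _ => rfl, ?_⟩
  · rintro ⟨e, n⟩ ⟨f, m⟩ h
    simp only [Prod.mk.injEq] at h
    obtain ⟨h₁, h₂⟩ := h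
    have aux : ∀ (x y : G.V) (hxy : x = y) (e' : {e : G.E // G.src e = x})
        (f' : {e : G.E // G.src e = y}), φ x (e', n) = φ y (f', m) → e'.1 = f'.1 ∧ n = m := by
      rintro x _ rfl e' f' h
      have := hφ x h
      simp only [Prod.mk.injEq] at this
      exact ⟨congrArg _ this.1, this.2⟩
    obtain ⟨h₃, h₄⟩ := aux _ _ h₁ ⟨e, rfl⟩ ⟨f, rfl⟩ h₂
    exact Prod.ext h₃ h₄
  · intro x n hx
    obtain ⟨⟨⟨e, rfl⟩, m⟩, h⟩ := hφ' x hx n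
    exact ⟨(e, m), Prod.ext rfl h⟩

variable {G}

/-- Every vertex is nonzero in the Leavitt path algebra. -/
theorem vert_ne_zero (x : G.V) : vert K x ≠ 0 := by
  classical
  obtain ⟨j, hj, hsrc, hreg⟩ := exists_code G
  let P : G.V → Module.End K (G.V × ℕ → K) := fun y =>
    { toFun := fun F a => if a.1 = y then F a else 0
      map_add' := by intro F F'; funext a; by_cases h : a.1 = y <;> simp [h]
      map_smul' := by intro k F; funext a; by_cases h : a.1 = y <;> simp [h] }
  let S : G.E → Module.End K (G.V × ℕ → K) := fun e =>
    { toFun := fun F a => if h : ∃ n, j (e, n) = a then F (G.rng e, h.choose) else 0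
      map_add' := by
        intro F F'; funext a; by_cases h : ∃ n, j (e, n) = a <;> simp [h]
      map_smul' := by
        intro k F; funext a; by_cases h : ∃ n, j (e, n) = a <;> simp [h] }
  let T : G.E → Module.End K (G.V × ℕ → K) := fun e =>
    { toFun := fun F a => if a.1 = G.rng e then F (j (e, a.2)) else 0
      map_add' := by intro F F'; funext a; by_cases h : a.1 = G.rng e <;> simp [h]
      map_smul' := by intro k F; funext a; by_cases h : a.1 = G.rng e <;> simp [h] }
  have hP : ∀ y F a, P y F a = if a.1 = y then F a else 0 := fun _ _ _ => rfl
  have hT : ∀ e F a, T e F a = if a.1 = G.rng e then F (j (e, a.2)) else 0 := fun _ _ _ => rfl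
  have hS1 : ∀ e F n, S e F (j (e, n)) = F (G.rng e, n) := by
    intro e F n
    have h : ∃ m, j (e, m) = j (e, n) := ⟨n, rfl⟩
    have h2 : h.choose = n := congrArg Prod.snd (hj h.choose_spec)
    calc S e F (j (e, n)) = F (G.rng e, h.choose) := dif_pos h
      _ = _ := by rw [h2]
  have hS0 : ∀ e F a, (¬ ∃ n, j (e, n) = a) → S e F a = 0 := fun e F a h => dif_neg h
  have fam : Leavitt.IsFamily G P S T := by
    refine ⟨?_, ?_, ?_, ?_, ?_, ?_, ?_, ?_, ?_⟩
    · intro y; ext F a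
      by_cases h : a.1 = y <;> simp [hP, Module.End.mul_apply, h]
    · intro y z hyz; ext F a
      by_cases h : a.1 = y
      · have : a.1 ≠ z := fun h' => hyz (h.symm.trans h')
        simp [hP, Module.End.mul_apply, this]
      · simp [hP, Module.End.mul_apply, h]
    · intro e; ext F a
      by_cases h : ∃ n, j (e, n) = a
      · obtain ⟨n, rfl⟩ := h
        simp [hP, Module.End.mul_apply, hsrc]
      · simp [hP, Module.End.mul_apply, hS0 e F a h]
    · intro e; ext F a
      by_cases h : ∃ n, j (e, n) = a
      · obtain ⟨n, rfl⟩ := h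
        simp [hP, Module.End.mul_apply, hS1]
      · simp [Module.End.mul_apply, hS0 e _ a h]
    · intro e; ext F a
      by_cases h : a.1 = G.rng e <;> simp [hP, hT, Module.End.mul_apply, h]
    · intro e; ext F a
      by_cases h : a.1 = G.rng e <;> simp [hP, hT, Module.End.mul_apply, h, hsrc]
    · intro e; ext F a
      obtain ⟨y, n⟩ := a
      by_cases h : y = G.rng e
      · subst h
        simp [hP, hT, Module.End.mul_apply, hS1]
      · simp [hP, hT, Module.End.mul_apply, h]
    · intro e f hef; ext F a
      have : ¬ ∃ n, j (f, n) = j (e, a.2) := by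
        rintro ⟨n, hn⟩
        exact hef (congrArg Prod.fst (hj hn)).symm
      simp [hT, Module.End.mul_apply, hS0 f F _ this]
    · intro y hy; ext F a
      rw [LinearMap.sum_apply, Finset.sum_apply, hP]
      obtain ⟨z, m⟩ := a
      by_cases h : z = y
      · subst h
        obtain ⟨⟨e, n⟩, hn⟩ := hreg z m hy
        have he : G.src e = z := by rw [← hsrc (e, n), hn]
        rw [← hn, Finset.sum_eq_single e]
        · simp [Module.End.mul_apply, hS1, hT, hsrc, he]
        · intro f _ hfe
          refine hS0 f _ _ ?_
          rintro ⟨n', hn'⟩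
          exact hfe (congrArg Prod.fst (hj hn'))
        · intro hne
          exact absurd (by simpa using he) hne
      · rw [if_neg h]
        refine Finset.sum_eq_zero fun e he => hS0 e _ _ ?_
        rintro ⟨n, hn⟩
        have he' : G.src e = y := by simpa using he
        exact h (by rw [← he', ← hsrc (e, n), hn])
  intro h0
  have h1 : P x = 0 := by rw [← lift_vert (K := K) fam x, h0, map_zero]
  have h2 := congrFun (LinearMap.congr_fun h1 (fun _ => (1 : K))) (x, 0)
  simp [hP] at h2

/-- For `H` hereditary and saturated, the vertices lying in `I(H)` are exactly those of `H`. -/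
theorem vert_mem_iff {H : Set G.V} (hH : G.IsHerSat H) (x : G.V) :
    vert K x ∈ vertexIdeal K H ↔ x ∈ H := by
  refine ⟨fun h => ?_, vert_mem K⟩
  by_contra hx
  have := vertexIdeal_le_ker K hH h
  rw [proj_vert K hH ⟨x, hx⟩] at this
  exact vert_ne_zero K _ this

/-- The vertices in an ideal of `L_K(G)` form a hereditary and saturated set. -/
theorem isHerSat_ideal (J : TwoSidedIdeal (LPA K G)) : G.IsHerSat {x | vert K x ∈ J} where
  her := RFGraph.isHereditary_of_rng fun e (he : vert K (G.src e) ∈ J) => by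
    change vert K (G.rng e) ∈ J
    rw [← (isFamily K G).ck1 e, ← (isFamily K G).ghost_src e]
    exact J.mul_mem_right _ _ (J.mul_mem_left _ _ he)
  sat x hx h := by
    change vert K x ∈ J
    rw [← (isFamily K G).ck2 x hx]
    refine sum_mem fun e he => ?_
    rw [← (isFamily K G).edge_rng e]
    exact J.mul_mem_right _ _ (J.mul_mem_left _ _ (h e (by simpa using he)))

/-- `T` is a set of vertices of `G` such that the canonical isomorphism
`θ : L_K(G) / I(H) ≅ L_K(G / H)` maps the ideal `I(T) / I(H)` onto the ideal `I(X)`. -/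
def LiftsIdeal {H : Set G.V} (hH : G.IsHerSat H) (X : Set (G.quot H hH.her).V) (T : Set G.V) :
    Prop :=
  vertexIdeal K H ≤ vertexIdeal K T ∧
    theta K hH '' (toQuot K H '' (vertexIdeal K T : Set (LPA K G))) =
      (vertexIdeal K X : Set (LPA K (G.quot H hH.her)))

theorem liftsIdeal_iff {H : Set G.V} (hH : G.IsHerSat H) (X : Set (G.quot H hH.her).V)
    (T : Set G.V) :
    (G.IsHerSat T ∧ LiftsIdeal K hH X T) ↔
      T = {x | proj K hH (vert K x) ∈ vertexIdeal K X} := by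
  constructor
  · rintro ⟨hT, hle, himg⟩
    rw [Set.image_image] at himg
    ext x
    refine ⟨fun hx => ?_, fun hx => ?_⟩
    · have : proj K hH (vert K x) ∈
          (vertexIdeal K X : Set (LPA K (G.quot H hH.her))) :=
        himg ▸ ⟨vert K x, vert_mem K hx, rfl⟩
      exact this
    · have hx' : proj K hH (vert K x) ∈
          (vertexIdeal K X : Set (LPA K (G.quot H hH.her))) := hx
      rw [← himg] at hx'
      obtain ⟨y, hy, hyx⟩ := hx'
      replace hyx : proj K hH y = proj K hH (vert K x) := hyx
      have h0 : vert K x - y ∈ vertexIdeal K H := by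
        rw [← proj_eq_zero K hH, map_sub, hyx, sub_self]
      have := (vertexIdeal K T).add_mem (hle h0) hy
      rw [sub_add_cancel] at this
      exact (vert_mem_iff K hT x).1 this
  · rintro rfl
    refine ⟨isHerSat_ideal K ((vertexIdeal K X).comap (proj K hH)), ?_, ?_⟩
    · refine (vertexIdeal_le K).2 fun x hx => vert_mem K ?_
      change proj K hH (vert K x) ∈ vertexIdeal K X
      rw [proj_vert_of_mem K hH hx]
      exact TwoSidedIdeal.zero_mem _
    · rw [Set.image_image]
      apply Set.Subset.antisymm
      · rintro _ ⟨y, hy, rfl⟩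
        have : vertexIdeal K {x | proj K hH (vert K x) ∈ vertexIdeal K X} ≤
            (vertexIdeal K X).comap (proj K hH) := (vertexIdeal_le K).2 fun x hx => hx
        exact this hy
      · intro y hy
        refine TwoSidedIdeal.span_induction (p := fun y _ => y ∈ (fun z => theta K hH
          (toQuot K H z)) '' (vertexIdeal K {x | proj K hH (vert K x) ∈ vertexIdeal K X} :
            Set (LPA K G))) ?_ ?_ ?_ ?_ ?_ ?_ hy
        · rintro _ ⟨x, hx, rfl⟩
          refine ⟨vert K x.1, vert_mem K ?_, proj_vert K hH x⟩
          change proj K hH (vert K x.1) ∈ vertexIdeal K X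
          rw [proj_vert K hH x]
          exact vert_mem K hx
        · exact ⟨0, TwoSidedIdeal.zero_mem _, by simp⟩
        · rintro _ _ _ _ ⟨a, ha, rfl⟩ ⟨b, hb, rfl⟩
          exact ⟨a + b, TwoSidedIdeal.add_mem _ ha hb, by simp⟩
        · rintro _ _ ⟨a, ha, rfl⟩
          exact ⟨-a, TwoSidedIdeal.neg_mem _ ha, by simp⟩
        · rintro c _ _ ⟨a, ha, rfl⟩
          obtain ⟨d, rfl⟩ := proj_surjective K hH c
          exact ⟨d * a, TwoSidedIdeal.mul_mem_left _ _ _ ha, by simp⟩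
        · rintro c _ _ ⟨a, ha, rfl⟩
          obtain ⟨d, rfl⟩ := proj_surjective K hH c
          exact ⟨a * d, TwoSidedIdeal.mul_mem_right _ _ _ ha, by simp⟩

/-- There is exactly one hereditary and saturated set `T` with `θ(I(T) / I(H)) = I(X)`. -/
theorem existsUnique_liftsIdeal {H : Set G.V} (hH : G.IsHerSat H)
    (X : Set (G.quot H hH.her).V) : ∃! T : Set G.V, G.IsHerSat T ∧ LiftsIdeal K hH X T :=
  ⟨_, (liftsIdeal_iff K hH X _).2 rfl, fun T hT => (liftsIdeal_iff K hH X T).1 hT⟩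

/-- The unique hereditary and saturated set `T` with `θ(I(T) / I(H)) = I(X)`. -/
noncomputable def liftSet {H : Set G.V} (hH : G.IsHerSat H) (X : Set (G.quot H hH.her).V) :
    Set G.V :=
  (existsUnique_liftsIdeal K hH X).choose

theorem liftSet_spec {H : Set G.V} (hH : G.IsHerSat H) (X : Set (G.quot H hH.her).V) :
    G.IsHerSat (liftSet K hH X) ∧ LiftsIdeal K hH X (liftSet K hH X) :=
  (existsUnique_liftsIdeal K hH X).choose_spec.1

theorem mem_liftSet {H : Set G.V} (hH : G.IsHerSat H) (X : Set (G.quot H hH.her).V) (x : G.V) :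
    x ∈ liftSet K hH X ↔ proj K hH (vert K x) ∈ vertexIdeal K X :=
  Set.ext_iff.1 ((liftsIdeal_iff K hH X _).1 (liftSet_spec K hH X)) x

end nonzero

/-! ### Functoriality -/

section functoriality

variable (K : Type w) [Field K] {G G' : RFGraph.{u, v}}

theorem isFamily_iso (α : RFGraph.Iso G G') :
    Leavitt.IsFamily G (A := LPA K G') (fun x => vert K (α.onV x)) (fun e => edg K (α.onE e))
      (fun e => gho K (α.onE e)) := by
  have F := isFamily K G'
  refine ⟨?_, ?_, ?_, ?_, ?_, ?_, ?_, ?_, ?_⟩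
  · intro x; exact F.vertex_idem _
  · intro x y h; exact F.vertex_orth _ _ (α.onV.injective.ne h)
  · intro e; rw [← α.src_comm]; exact F.src_edge _
  · intro e; rw [← α.rng_comm]; exact F.edge_rng _
  · intro e; rw [← α.rng_comm]; exact F.rng_ghost _
  · intro e; rw [← α.src_comm]; exact F.ghost_src _
  · intro e; rw [← α.rng_comm]; exact F.ck1 _
  · intro e f h; exact F.ck1_orth _ _ (α.onE.injective.ne h)
  · intro x hx
    have hreg : G'.IsRegular (α.onV x) := by
      obtain ⟨e, he⟩ := hx.1
      exact ⟨⟨α.onE e, (α.src_comm e).trans (congrArg _ he)⟩, G'.rowFinite _⟩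
    rw [← F.ck2 _ hreg]
    refine Finset.sum_equiv α.onE (fun e => ?_) (fun _ _ => rfl)
    simp [α.src_comm]

/-- The homomorphism of Leavitt path algebras induced by a graph isomorphism. -/
noncomputable def mapIso (α : RFGraph.Iso G G') : LPA K G →ₙₐ[K] LPA K G' :=
  lift (isFamily_iso K α)

theorem mapIso_mem (α : RFGraph.Iso G G') {X : Set G.V} {X' : Set G'.V}
    (h : ∀ x ∈ X, α.onV x ∈ X') {y : LPA K G} (hy : y ∈ vertexIdeal K X) :
    mapIso K α y ∈ vertexIdeal K X' := by
  have : vertexIdeal K X ≤ (vertexIdeal K X').comap (mapIso K α) :=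
    (vertexIdeal_le K).2 fun x hx => by
      rw [TwoSidedIdeal.mem_comap, mapIso, lift_vert]
      exact vert_mem K (h x hx)
  exact this hy

end functoriality

end LPA

/-! ## Point functors -/

/-- A point functor: a subfunctor of the vertex functor. -/
abbrev PointFunctor := Subfunctor RFGraph.vertexFunctor.{u, v}

namespace PointFunctor

/-- The set of vertices of `G` selected by a point functor. -/
abbrev pts (H : PointFunctor.{u, v}) (G : RFGraph.{u, v}) : Set G.V := H.obj G

/-- A point functor `H` is hereditary and saturated if all the sets `H(G)` are. -/
abbrev IsHerSat (H : PointFunctor.{u, v}) : Prop := ∀ G : RFGraph.{u, v}, G.IsHerSat (H.pts G)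

/-- A point functor `H` is invariant under isomorphism if `f(I(H(G))) = I(H(G'))` for every ring
isomorphism `f : L_K(G) → L_K(G')`. -/
def IsInvariant (K : Type w) [Field K] (H : PointFunctor.{u, v}) : Prop :=
  ∀ (G G' : RFGraph.{u, v}) (f : LPA K G ≃+* LPA K G'),
    f '' (LPA.vertexIdeal K (H.pts G) : Set (LPA K G)) =
      (LPA.vertexIdeal K (H.pts G') : Set (LPA K G'))

theorem pts_map (H : PointFunctor.{u, v}) {G G' : RFGraph.{u, v}} (α : RFGraph.Iso G G')
    {x : G.V} (hx : x ∈ H.pts G) : α.onV x ∈ H.pts G' :=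
  H.map (U := G) (V := G') α hx

theorem pts_map_iff (H : PointFunctor.{u, v}) {G G' : RFGraph.{u, v}} (α : RFGraph.Iso G G')
    (x : G.V) : α.onV x ∈ H.pts G' ↔ x ∈ H.pts G := by
  refine ⟨fun h => ?_, H.pts_map α⟩
  let β : RFGraph.Iso G' G := ⟨α.onV.symm, α.onE.symm,
    fun e => by rw [Equiv.eq_symm_apply, ← α.src_comm, Equiv.apply_symm_apply],
    fun e => by rw [Equiv.eq_symm_apply, ← α.rng_comm, Equiv.apply_symm_apply]⟩
  have := H.pts_map β h
  rwa [show β.onV (α.onV x) = x from α.onV.symm_apply_apply x] at this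

end PointFunctor

/-- Hereditary and saturated point functors. -/
structure HSPointFunctor where
  toPointFunctor : PointFunctor.{u, v}
  isHerSat : toPointFunctor.IsHerSat

namespace HSPointFunctor

/-- The quotient graph `G / H(G)`. -/
def quotGraph (H : HSPointFunctor.{u, v}) (G : RFGraph.{u, v}) : RFGraph.{u, v} :=
  G.quot (H.toPointFunctor.pts G) (H.isHerSat G).her

/-- The composition `H₂ * H₁` of hereditary and saturated point functors: `(H₂ * H₁)(G)` is the
unique hereditary and saturated set `T` of vertices of `G` such that
`θ : L_K(G) / I(H₁(G)) ≅ L_K(G / H₁(G))` maps `I(T) / I(H₁(G))` onto `I(H₂(G / H₁(G)))`. -/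
noncomputable def star (K : Type w) [Field K] (H₂ H₁ : HSPointFunctor.{u, v}) :
    HSPointFunctor.{u, v} where
  toPointFunctor :=
    { obj := fun G => LPA.liftSet K (H₁.isHerSat G) (H₂.toPointFunctor.pts (H₁.quotGraph G))
      map := by
        intro G G' (α : RFGraph.Iso G G') (x : G.V) hx
        refine (LPA.mem_liftSet K (H₁.isHerSat G') _ (α.onV x)).2 ?_
        replace hx := (LPA.mem_liftSet K (H₁.isHerSat G) _ x).1 hx
        have hα := H₁.toPointFunctor.pts_map_iff α
        by_cases h : x ∈ H₁.toPointFunctor.pts G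
        · rw [LPA.proj_vert_of_mem K _ ((hα x).2 h)]
          exact TwoSidedIdeal.zero_mem _
        · let β : RFGraph.Iso (H₁.quotGraph G) (H₁.quotGraph G') :=
            α.quot (H₁.isHerSat G).her (H₁.isHerSat G').her hα
          rw [LPA.proj_vert K _ ⟨x, h⟩] at hx
          rw [LPA.proj_vert K _ ⟨α.onV x, fun h' => h ((hα x).1 h')⟩]
          have := LPA.mapIso_mem K β (fun y hy => H₂.toPointFunctor.pts_map β hy) hx
          have hv : LPA.mapIso K β (LPA.vert K ⟨x, h⟩) = LPA.vert K (β.onV ⟨x, h⟩) :=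
            LPA.lift_vert _ _
          exact hv ▸ this }
  isHerSat G := (LPA.liftSet_spec K (H₁.isHerSat G) _).1

end HSPointFunctor

/-!
Both composites select the same vertices of every graph `G`, so the two point functors are equal
and not merely isomorphic.

A vertex lies in `(H₂ * H₁)(G)` exactly when it lies in `H₁(G)` or is selected by `H₂` in the graph
`G / H₁(G)` (`HSPointFunctor.mem_star`); this holds because the projection `L_K(G) → L_K(G / H₁(G))`
sends a vertex to zero or to itself, and the only vertices in the ideal generated by a hereditary
and saturated set are its elements. Unfolding both sides with this description, the vertices of
`H₃(G)` and those selected by `H₂` in `G / H₃(G)` appear on both. What is left is whether `H₁`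
selects `x` in `(G / H₃(G)) / H₂(G / H₃(G))` or in `G / (H₂ * H₃)(G)`. These iterated and single
quotients are isomorphic graphs, compatibly with the vertices of `G` (`RFGraph.quotQuotIso`), and a
point functor is respected by graph isomorphisms.
-/

namespace RFGraph

/-- The isomorphism `(G / H) / X ≅ G / T` of quotient graphs, where the set `T` of vertices of `G`
is the union of `H` and `X`. The set `X` consists of vertices of `G / H`, so the condition on `T`
is stated with an existential over proofs that a vertex lies outside `H`. -/
def quotQuotIso {G : RFGraph.{u, v}} {H : Set G.V} (hH : G.IsHereditary H)
    {X : Set (G.quot H hH).V} (hX : (G.quot H hH).IsHereditary X)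
    {T : Set G.V} (hT : G.IsHereditary T)
    (h : ∀ x, x ∈ T ↔ x ∈ H ∨ ∃ hx : x ∉ H, (⟨x, hx⟩ : (G.quot H hH).V) ∈ X) :
    Iso ((G.quot H hH).quot X hX) (G.quot T hT) where
  onV :=
    { toFun := fun x => ⟨x.1.1, fun hx => ((h _).1 hx).elim x.1.2 fun ⟨_, hx'⟩ => x.2 hx'⟩
      invFun := fun x => ⟨⟨x.1, fun hx => x.2 ((h _).2 (Or.inl hx))⟩,
        fun hx => x.2 ((h _).2 (Or.inr ⟨_, hx⟩))⟩
      left_inv := fun _ => rfl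
      right_inv := fun _ => rfl }
  onE :=
    { toFun := fun e => ⟨e.1.1, fun he => ((h _).1 he).elim e.1.2 fun ⟨_, he'⟩ => e.2 he'⟩
      invFun := fun e => ⟨⟨e.1, fun he => e.2 ((h _).2 (Or.inl he))⟩,
        fun he => e.2 ((h _).2 (Or.inr ⟨_, he⟩))⟩
      left_inv := fun _ => rfl
      right_inv := fun _ => rfl }
  src_comm _ := rfl
  rng_comm _ := rfl

end RFGraph

namespace HSPointFunctor

variable (K : Type w) [Field K]

/-- The vertices of `(H₂ * H₁)(G)` are those of `H₁(G)` and those of `H₂(G / H₁(G))`. -/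
theorem mem_star (H₂ H₁ : HSPointFunctor.{u, v}) (G : RFGraph.{u, v}) (x : G.V) :
    x ∈ (star K H₂ H₁).toPointFunctor.pts G ↔
      x ∈ H₁.toPointFunctor.pts G ∨ ∃ hx : x ∉ H₁.toPointFunctor.pts G,
        (⟨x, hx⟩ : (H₁.quotGraph G).V) ∈ H₂.toPointFunctor.pts (H₁.quotGraph G) := by
  refine (LPA.mem_liftSet K (H₁.isHerSat G) _ x).trans ?_
  by_cases h : x ∈ H₁.toPointFunctor.pts G
  · rw [LPA.proj_vert_of_mem K _ h]
    exact iff_of_true (TwoSidedIdeal.zero_mem _) (Or.inl h)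
  · rw [LPA.proj_vert K _ ⟨x, h⟩]
    refine (LPA.vert_mem_iff K (H₂.isHerSat (H₁.quotGraph G)) _).trans ?_
    exact ⟨fun hx => Or.inr ⟨h, hx⟩, fun hx => hx.elim (fun h' => absurd h' h) fun ⟨_, hx⟩ => hx⟩

/-- The composition of hereditary and saturated point functors is associative. -/
theorem star_assoc (H₁ H₂ H₃ : HSPointFunctor.{u, v}) :
    (star K (star K H₁ H₂) H₃).toPointFunctor = (star K H₁ (star K H₂ H₃)).toPointFunctor := by
  refine Subfunctor.ext (funext fun G => Set.ext fun (x : G.V) => ?_)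
  refine (mem_star K _ _ G x).trans (Iff.trans ?_ (mem_star K _ _ G x).symm)
  let α := RFGraph.quotQuotIso (H₃.isHerSat G).her (H₂.isHerSat (H₃.quotGraph G)).her
    ((star K H₂ H₃).isHerSat G).her (mem_star K H₂ H₃ G)
  by_cases h₃ : x ∈ H₃.toPointFunctor.pts G
  · exact iff_of_true (Or.inl h₃) (Or.inl ((mem_star K _ _ G x).2 (Or.inl h₃)))
  by_cases h₂ : (⟨x, h₃⟩ : (H₃.quotGraph G).V) ∈ H₂.toPointFunctor.pts (H₃.quotGraph G)
  · exact iff_of_true (Or.inr ⟨h₃, (mem_star K _ _ _ _).2 (Or.inl h₂)⟩)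
      (Or.inl ((mem_star K _ _ G x).2 (Or.inr ⟨h₃, h₂⟩)))
  have hx : x ∉ (star K H₂ H₃).toPointFunctor.pts G := fun hx =>
    ((mem_star K _ _ G x).1 hx).elim h₃ fun ⟨_, hx⟩ => h₂ hx
  have key := H₁.toPointFunctor.pts_map_iff α ⟨⟨x, h₃⟩, h₂⟩
  constructor
  · rintro (hx' | ⟨_, hx'⟩)
    · exact absurd hx' h₃
    · rcases (mem_star K _ _ _ _).1 hx' with hx' | ⟨_, hx'⟩
      · exact absurd hx' h₂
      · exact Or.inr ⟨hx, key.2 hx'⟩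
  · rintro (hx' | ⟨_, hx'⟩)
    · exact absurd hx' hx
    · exact Or.inr ⟨h₃, (mem_star K _ _ _ _).2 (Or.inr ⟨h₂, key.1 hx'⟩)⟩

end HSPointFunctor

/-- For invariant hereditary and saturated point functors `H₁`, `H₂`, `H₃` there is a natural
isomorphism of functors `(H₁ * H₂) * H₃ ≅ H₁ * (H₂ * H₃)`. -/
theorem proposition5p5 (K : Type w) [Field K] (H₁ H₂ H₃ : HSPointFunctor.{u, v})
    (h₁ : H₁.toPointFunctor.IsInvariant K) (h₂ : H₂.toPointFunctor.IsInvariant K)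
    (h₃ : H₃.toPointFunctor.IsInvariant K) :
    Nonempty
      ((HSPointFunctor.star K (HSPointFunctor.star K H₁ H₂) H₃).toPointFunctor.toFunctor ≅
        (HSPointFunctor.star K H₁ (HSPointFunctor.star K H₂ H₃)).toPointFunctor.toFunctor) := by
  exact ⟨eqToIso (congrArg _ (HSPointFunctor.star_assoc K H₁ H₂ H₃))⟩
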